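/- Fix a set $K$. A Kripke model $\mathfrak M=\langle W,R,\{P_k\}_{k\in K}\rangle$ consists of a nonempty set $W$, a binary relation $R$ on $W$ and a subset $P_k\subseteq W$ for each $k\in K$; it is identified with a structure for first-order logic with equality over the signature with one binary predicate symbol $\mathbf R$ and unary predicate symbols $\mathbf P_k$ ($k\in K$). The disjoint union $\mathfrak M\uplus\mathfrak M'$ is the Kripke model on the disjoint union of the sets of worlds in which accessibility and the predicates are those inherited from $\mathfrak M$ and $\mathfrak M'$, with no accessibility between the two parts. Let $\smile,\frown$ be two unary connectives (negations) and let $\circ_\smile,\circ_\frown,\bullet_\smile,\bullet_\frown$ be four further unary connectives (their restoration companions). A restorative similarity type is a subset $\Lambda$ of these six connectives. Let $\mathcal L_{\sim,\Lambda}$ be the language generated by $$\phi ::= p_k \mid \top \mid \bot \mid \phi\wedge\phi \mid \phi\vee\phi \mid {\sim}\phi \mid \ast\,\phi \qquad (k\in K,\ \ast\in\Lambda).$$ Its standard translation into first-order logic is given by $\mathrm{st}(x,p_k)=\mathbf P_kx$, $\mathrm{st}(x,\top)=(x=x)$, $\mathrm{st}(x,\bot)={\sim}(x=x)$, by commuting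 with $\wedge,\vee,{\sim}$, and by - $\mathrm{st}(x,\smile\phi)=\exists y(x\mathbf Ry\wedge{\sim}\mathrm{st}(y,\phi))$, - $\mathrm{st}(x,\frown\phi)=\forall y(x\mathbf Ry\to{\sim}\mathrm{st}(y,\phi))$, - $\mathrm{st}(x,\circ_\smile\phi)={\sim}\mathrm{st}(x,\phi)\vee\forall y(x\mathbf Ry\to\mathrm{st}(y,\phi))$, - $\mathrm{st}(x,\circ_\frown\phi)=\mathrm{st}(x,\phi)\vee\forall y(x\mathbf Ry\to{\sim}\mathrm{st}(y,\phi))$, - $\mathrm{st}(x,\bullet_\smile\phi)=\mathrm{st}(x,\phi)\wedge\exists y(x\mathbf Ry\wedge{\sim}\mathrm{st}(y,\phi))$, - $\mathrm{st}(x,\bullet_\frown\phi)={\sim}\mathrm{st}(x,\phi)\wedge\exists y(x\mathbf Ry\wedge\mathrm{st}(y,\phi))$. A symmetrical $\Lambda$-simulation on a Kripke model $\langle W,R,\{P_k\}_{k\in K}\rangle$ is a symmetric relation $S\subseteq W\times W$ such that $(w,v)\in S$ and $w\in P_k$ imply $v\in P_k$ for every $k\in K$, and which satisfies the condition below of each connective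 that belongs to $\Lambda$, for all worlds involved: - $\smile$: if $(w,v)\in S$ and $wRs$, then there is $t$ with $vRt$ and $(t,s)\in S$; - $\frown$: if $(w,v)\in S$ and $vRt$, then there is $s$ with $wRs$ and $(t,s)\in S$; - $\circ_\smile$: if $(w,v)\in S$ and $vRt$, then $(v,t)\in S$, or both $(v,w)\in S$ and there is $s$ with $wRs$ and $(s,t)\in S$; - $\circ_\frown$: if $(w,v)\in S$ and $vRt$, then $(t,v)\in S$, or there is $s$ with $wRs$ and $(t,s)\in S$; - $\bullet_\smile$: if $(w,v)\in S$ and $wRs$, then $(w,s)\in S$, or there is $t$ with $vRt$ and $(t,s)\in S$; - $\bullet_\frown$: if $(w,v)\in S$ and $wRs$, then $(s,w)\in S$, or both $(v,w)\in S$ and there is $t$ with $vRt$ and $(s,t)\in S$. A symmetrical $\Lambda$-simulation between Kripke models $\mathfrak M$ and $\mathfrak M'$ is a symmetrical $\Lambda$-simulation on $\mathfrak M\uplus\mathfrak M'$. A first-order formula $\alpha(x)$ with at most the variable $x$ free is invariant under symmetrical $\Lambda$-simulations if for all Kripke models $\mathfrak M,\mathfrak M'$, every symmetrical $\Lambda$-simulation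 $S$ between them, and all worlds $w$ of $\mathfrak M$ and $w'$ of $\mathfrak M'$ with $(w,w')\in S$, $$\mathfrak M\Vdash\alpha(x)[w]\iff\mathfrak M'\Vdash\alpha(x)[w'].$$ **Theorem.** Let $\Lambda$ be a restorative similarity type and let $\alpha(x)$ be a first-order formula (over the above signature, with equality) with one free variable $x$. Then $\alpha(x)$ is equivalent (that is, true at the same worlds of all Kripke models) to $\mathrm{st}(x,\phi)$ for some $\mathcal L_{\sim,\Lambda}$-formula $\phi$ if and only if $\alpha(x)$ is invariant under symmetrical $\Lambda$-simulations. -/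

import Mathlib

universe u v

namespace Restorative



/-! ### Kripke models -/

/-- A Kripke model over a set `K` of (indices of) propositional letters: a nonempty set of worlds,
an accessibility relation, and the truth set of every propositional letter. -/
structure KripkeModel (K : Type u) where
  World : Type v
  nonempty : Nonempty World
  R : World → World → Prop
  P : K → World → Prop

/-- The disjoint union of two Kripke models: two worlds are linked by the accessibility relation
iff they come from the same model and are linked there. -/
def KripkeModel.disjointUnion {K : Type u} (M N : KripkeModel.{u, v} K) :
    KripkeModel.{u, v} K where
  World := M.World ⊕ N.World
  nonempty := M.nonempty.map Sum.inl
  R := Sum.LiftRel M.R N.R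
  P := fun k => Sum.elim (M.P k) (N.P k)

/-! ### The modal language -/

/-- The six negative and restoration modalities. Their meaning at a world `w`:
* `diaNeg φ`  : some successor of `w` refutes `φ`;
* `boxNeg φ`  : every successor of `w` refutes `φ`;
* `cons φ`    : `w` refutes `φ`, or every successor satisfies `φ` (white circle with a smile);
* `det φ`     : `w` satisfies `φ`, or every successor refutes `φ` (white circle with a frown);
* `incons φ`  : `w` satisfies `φ`, and some successor refutes `φ` (black circle with a smile);
* `undet φ`   : `w` refutes `φ`, and some successor satisfies `φ` (black circle with a frown). -/
inductive Modality : Type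
  | diaNeg
  | boxNeg
  | cons
  | det
  | incons
  | undet

/-- The language generated from the letters `p_k`, `k ∈ K`, by `⊤`, `⊥`, `∧`, `∨`, classical
negation and the modalities in the restorative similarity type `Λ`. -/
inductive ModalFormula (K : Type u) (Λ : Set Modality) : Type u
  | letter (k : K) : ModalFormula K Λ
  | top : ModalFormula K Λ
  | bot : ModalFormula K Λ
  | and (φ ψ : ModalFormula K Λ) : ModalFormula K Λ
  | or (φ ψ : ModalFormula K Λ) : ModalFormula K Λ
  | neg (φ : ModalFormula K Λ) : ModalFormula K Λ
  | modal (c : Modality) (hc : c ∈ Λ) (φ : ModalFormula K Λ) : ModalFormula K Λ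

/-! ### The first-order language (with equality) -/

/-- One binary relation symbol and one unary relation symbol for each `k ∈ K`. -/
inductive KripkeRelation (K : Type u) : ℕ → Type u
  | acc : KripkeRelation K 2
  | pred (k : K) : KripkeRelation K 1

/-- The first-order signature of Kripke models; there are no function symbols. -/
def kripkeLanguage (K : Type u) : FirstOrder.Language.{0, u} where
  Functions := fun _ => Empty
  Relations := KripkeRelation K

/-- The binary predicate symbol of the signature. -/
def symR (K : Type u) : (kripkeLanguage K).Relations 2 := KripkeRelation.acc

/-- The unary predicate symbol of the letter `p_k`. -/
def symP {K : Type u} (k : K) : (kripkeLanguage K).Relations 1 := KripkeRelation.pred k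

/-- A Kripke model regarded as a first-order structure. -/
instance KripkeModel.toStructure {K : Type u} (M : KripkeModel.{u, v} K) :
    (kripkeLanguage K).Structure M.World where
  funMap := fun f _ => nomatch f
  RelMap := fun r xs =>
    match r, xs with
    | KripkeRelation.acc, xs => M.R (xs 0) (xs 1)
    | KripkeRelation.pred k, xs => M.P k (xs 0)

/-- First-order formulas `α(x)` whose only possible free variable is `x` (the unique element of
`Unit`). -/
abbrev FOFormula (K : Type u) : Type u := (kripkeLanguage K).Formula Unit

/-- `M ⊩ α(x)[w]`. -/
def Holds {K : Type u} (M : KripkeModel.{u, v} K) (α : FOFormula K) (w : M.World) : Prop :=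
  α.Realize (fun _ : Unit => w)

/-- Two formulas `α(x)`, `β(x)` are equivalent: they hold at the same worlds of all models. -/
def Equivalent {K : Type u} (α β : FOFormula K) : Prop :=
  ∀ (M : KripkeModel.{u, v} K) (w : M.World), Holds M α w ↔ Holds M β w

/-! ### The standard translation -/

section Translation

variable {K : Type u} {n : ℕ}

/-- The atomic formula `P_k x`. Variables are either the free variable (`Sum.inl ()`) or one of
the `n` variables that are to be bound by enclosing quantifiers. -/
def atomP (k : K) (x : Unit ⊕ Fin n) : (kripkeLanguage K).BoundedFormula Unit n :=
  (symP k).boundedFormula₁ (FirstOrder.Language.Term.var x)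

/-- The atomic formula `x R y`. -/
def atomR (x y : Unit ⊕ Fin n) : (kripkeLanguage K).BoundedFormula Unit n :=
  (symR K).boundedFormula₂
    (FirstOrder.Language.Term.var x) (FirstOrder.Language.Term.var y)

/-- The formula `x = x`. -/
def selfEq (x : Unit ⊕ Fin n) : (kripkeLanguage K).BoundedFormula Unit n :=
  FirstOrder.Language.Term.bdEqual (FirstOrder.Language.Term.var x) (FirstOrder.Language.Term.var x)

/-- The variable `x`, seen in the scope of one more quantifier. -/
def old (x : Unit ⊕ Fin n) : Unit ⊕ Fin (n + 1) := Sum.map id Fin.castSucc x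

/-- The variable bound by the innermost quantifier. -/
def fresh : Unit ⊕ Fin (n + 1) := Sum.inr (Fin.last n)

/-- `(∃ y) (x R y ∧ β)`, where `β` may mention the variable `y = fresh`. -/
def exSucc (x : Unit ⊕ Fin n) (β : (kripkeLanguage K).BoundedFormula Unit (n + 1)) :
    (kripkeLanguage K).BoundedFormula Unit n :=
  (atomR (old x) fresh ⊓ β).ex

/-- `(∀ y) (x R y → β)`, where `β` may mention the variable `y = fresh`. -/
def allSucc (x : Unit ⊕ Fin n) (β : (kripkeLanguage K).BoundedFormula Unit (n + 1)) :
    (kripkeLanguage K).BoundedFormula Unit n :=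
  ((atomR (old x) fresh).imp β).all

/-- The standard translation `st(x, φ)`. -/
def st {Λ : Set Modality} :
    {n : ℕ} → (Unit ⊕ Fin n) → ModalFormula K Λ → (kripkeLanguage K).BoundedFormula Unit n
  | _, x, .letter k => atomP k x
  | _, x, .top => selfEq x
  | _, x, .bot => (selfEq x).not
  | _, x, .and φ ψ => st x φ ⊓ st x ψ
  | _, x, .or φ ψ => st x φ ⊔ st x ψ
  | _, x, .neg φ => (st x φ).not
  | _, x, .modal .diaNeg _ φ => exSucc x (st fresh φ).not
  | _, x, .modal .boxNeg _ φ => allSucc x (st fresh φ).not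
  | _, x, .modal .cons _ φ => (st x φ).not ⊔ allSucc x (st fresh φ)
  | _, x, .modal .det _ φ => st x φ ⊔ allSucc x (st fresh φ).not
  | _, x, .modal .incons _ φ => st x φ ⊓ exSucc x (st fresh φ).not
  | _, x, .modal .undet _ φ => (st x φ).not ⊓ exSucc x (st fresh φ)

/-- The standard translation of `φ` at the free variable `x`. -/
def standardTranslation {Λ : Set Modality} (φ : ModalFormula K Λ) : FOFormula K :=
  st (n := 0) (Sum.inl ()) φ

end Translation

/-! ### Simulations -/

/-- The simulation condition attached to each modality. -/
def SimCondition {K : Type u} (M : KripkeModel.{u, v} K) (S : M.World → M.World → Prop) :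
    Modality → Prop
  | .diaNeg => ∀ w v s, S w v → M.R w s → ∃ t, M.R v t ∧ S t s
  | .boxNeg => ∀ w v t, S w v → M.R v t → ∃ s, M.R w s ∧ S t s
  | .cons => ∀ w v t, S w v → M.R v t → S v t ∨ (S v w ∧ ∃ s, M.R w s ∧ S s t)
  | .det => ∀ w v t, S w v → M.R v t → S t v ∨ ∃ s, M.R w s ∧ S t s
  | .incons => ∀ w v s, S w v → M.R w s → S w s ∨ ∃ t, M.R v t ∧ S t s
  | .undet => ∀ w v s, S w v → M.R w s → S s w ∨ (S v w ∧ ∃ t, M.R v t ∧ S s t)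

/-- `S` is a `Λ`-simulation on `M`. -/
structure IsSimulation {K : Type u} (Λ : Set Modality) (M : KripkeModel.{u, v} K)
    (S : M.World → M.World → Prop) : Prop where
  letter : ∀ (k : K) (w v : M.World), S w v → M.P k w → M.P k v
  modal : ∀ c ∈ Λ, SimCondition M S c

/-- `S` is a symmetrical `Λ`-simulation on `M`. -/
structure IsSymmetricalSimulation {K : Type u} (Λ : Set Modality) (M : KripkeModel.{u, v} K)
    (S : M.World → M.World → Prop) : Prop extends IsSimulation Λ M S where
  symm : ∀ w v, S w v → S v w

/-- A symmetrical `Λ`-simulation between two models is one on their disjoint union. -/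
def IsSymmetricalSimulationBetween {K : Type u} (Λ : Set Modality) (M N : KripkeModel.{u, v} K)
    (S : (M.disjointUnion N).World → (M.disjointUnion N).World → Prop) : Prop :=
  IsSymmetricalSimulation Λ (M.disjointUnion N) S

/-- `α(x)` is invariant under symmetrical `Λ`-simulations (between Kripke models). -/
def IsInvariant {K : Type u} (Λ : Set Modality) (α : FOFormula K) : Prop :=
  ∀ (M N : KripkeModel.{u, v} K)
    (S : (M.disjointUnion N).World → (M.disjointUnion N).World → Prop),
    IsSymmetricalSimulationBetween Λ M N S →
    ∀ (w : M.World) (w' : N.World), S (Sum.inl w) (Sum.inr w') →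
      (Holds M α w ↔ Holds N α w')

end Restorative

universe w

/-! For a symmetric relation each of the six simulation conditions is a forth condition: a step
`w R s` is matched by a step `v R t` with `t`, `s` related, or else, for the four restoration
connectives only, `s` is related to its own predecessor `w`. Dually, the connectives are, up to
negations, the operators `◇X` and `∼X ∧ ◇X`. These are preserved by simulations, and on saturated
models modal equivalence is itself a symmetrical simulation: if `s` is not modally equivalent to
`w`, conjoining `X` with a formula true at `s` and false at `w` makes the clause `∼X` automatic.

A first-order formula contains finitely many letters, so renaming letters reduces the converse to
a countable set of letters. If an invariant `α` is, for no `n`, a Boolean combination of the first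
`n` modal formulas, then for every `n` two pointed models agree on these formulas and differ on `α`;
the ultraproducts over `n` of both families are saturated and modally equivalent at the chosen
worlds, contradicting invariance.
-/

namespace Restorative

open FirstOrder FirstOrder.Language Filter

/-! ### Semantics of the modal language -/

/-- Truth of a modal formula at a world, the local satisfaction relation of the paper. -/
def Sat {K : Type u} {Λ : Set Modality} (M : KripkeModel.{u, v} K) :
    ModalFormula K Λ → M.World → Prop
  | .letter k, w => M.P k w
  | .top, _ => True
  | .bot, _ => False
  | .and φ ψ, w => Sat M φ w ∧ Sat M ψ w
  | .or φ ψ, w => Sat M φ w ∨ Sat M ψ w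
  | .neg φ, w => ¬ Sat M φ w
  | .modal .diaNeg _ φ, w => ∃ s, M.R w s ∧ ¬ Sat M φ s
  | .modal .boxNeg _ φ, w => ∀ s, M.R w s → ¬ Sat M φ s
  | .modal .cons _ φ, w => ¬ Sat M φ w ∨ ∀ s, M.R w s → Sat M φ s
  | .modal .det _ φ, w => Sat M φ w ∨ ∀ s, M.R w s → ¬ Sat M φ s
  | .modal .incons _ φ, w => Sat M φ w ∧ ∃ s, M.R w s ∧ ¬ Sat M φ s
  | .modal .undet _ φ, w => ¬ Sat M φ w ∧ ∃ s, M.R w s ∧ Sat M φ s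

section StandardTranslation

variable {K : Type u} {Λ : Set Modality} {M : KripkeModel.{u, v} K} {n : ℕ}
  (e : Unit → M.World) (xs : Fin n → M.World) (x y : Unit ⊕ Fin n)

theorem realize_atomP (k : K) :
    (atomP k x).Realize e xs ↔ M.P k (Sum.elim e xs x) :=
  BoundedFormula.realize_rel₁

theorem realize_atomR :
    (atomR (K := K) x y).Realize e xs ↔ M.R (Sum.elim e xs x) (Sum.elim e xs y) :=
  BoundedFormula.realize_rel₂

theorem elim_snoc_old (a : M.World) :
    Sum.elim e (Fin.snoc xs a : Fin (n + 1) → M.World) (old x) = Sum.elim e xs x := by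
  rcases x with x | x <;> simp [old]

theorem elim_snoc_fresh (a : M.World) :
    Sum.elim e (Fin.snoc xs a : Fin (n + 1) → M.World) fresh = a := by
  simp [fresh]

theorem realize_exSucc (β : (kripkeLanguage K).BoundedFormula Unit (n + 1)) :
    (exSucc x β).Realize e xs ↔
      ∃ s, M.R (Sum.elim e xs x) s ∧ β.Realize e (Fin.snoc xs s) := by
  simp [exSucc, realize_atomR, elim_snoc_old, elim_snoc_fresh]

theorem realize_allSucc (β : (kripkeLanguage K).BoundedFormula Unit (n + 1)) :
    (allSucc x β).Realize e xs ↔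
      ∀ s, M.R (Sum.elim e xs x) s → β.Realize e (Fin.snoc xs s) := by
  simp [allSucc, realize_atomR, elim_snoc_old, elim_snoc_fresh]

theorem realize_st (φ : ModalFormula K Λ) {n : ℕ} (xs : Fin n → M.World) (x : Unit ⊕ Fin n) :
    (st x φ).Realize e xs ↔ Sat M φ (Sum.elim e xs x) := by
  induction φ generalizing n with
  | letter k => exact realize_atomP e xs x k
  | top | bot => simp [st, Sat, selfEq]
  | and φ ψ ihφ ihψ | or φ ψ ihφ ihψ => simp [st, Sat, ihφ, ihψ]
  | neg φ ih => simp [st, Sat, ih]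
  | modal c hc φ ih =>
    cases c <;> simp [st, Sat, ih, realize_exSucc, realize_allSucc, elim_snoc_fresh]

theorem holds_standardTranslation (φ : ModalFormula K Λ) (w : M.World) :
    Holds M (standardTranslation φ) w ↔ Sat M φ w :=
  realize_st _ φ _ _

end StandardTranslation

/-- A bounded morphism between Kripke models: worlds correspond to worlds with the same letters,
and the successors of `f w` are exactly the images of the successors of `w`. -/
structure IsBoundedMorphism {K : Type u} {M N : KripkeModel.{u, v} K}
    (f : M.World → N.World) : Prop where
  letter : ∀ k w, N.P k (f w) ↔ M.P k w
  succ : ∀ w x, N.R (f w) x ↔ ∃ s, M.R w s ∧ f s = x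

section BoundedMorphism

variable {K : Type u} {Λ : Set Modality} {M N : KripkeModel.{u, v} K}

theorem IsBoundedMorphism.sat_iff {f : M.World → N.World} (hf : IsBoundedMorphism f)
    (φ : ModalFormula K Λ) (w : M.World) : Sat N φ (f w) ↔ Sat M φ w := by
  induction φ generalizing w with
  | letter k => exact hf.letter k w
  | top | bot => exact Iff.rfl
  | and φ ψ ihφ ihψ | or φ ψ ihφ ihψ => simp only [Sat, ihφ, ihψ]
  | neg φ ih => simp only [Sat, ih]
  | modal c hc φ ih =>
    cases c <;> simp [Sat, hf.succ, ih]

theorem isBoundedMorphism_inl : IsBoundedMorphism (N := M.disjointUnion N) Sum.inl where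
  letter _ _ := Iff.rfl
  succ w x := by cases x <;> simp [KripkeModel.disjointUnion]

theorem isBoundedMorphism_inr : IsBoundedMorphism (N := M.disjointUnion N) Sum.inr where
  letter _ _ := Iff.rfl
  succ w x := by cases x <;> simp [KripkeModel.disjointUnion]

end BoundedMorphism

/-! ### The two shapes of modalities -/

/-- The four restoration connectives, as opposed to the two negations. -/
def Modality.IsRestoration : Modality → Prop
  | .diaNeg | .boxNeg => False
  | .cons | .det | .incons | .undet => True

/-- The possibility operator underlying a modality `c`: `◇X` for the negations and `∼X ∧ ◇X` for
the restoration connectives. Up to classical negations of argument and value it is `c` itself. -/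
def Modality.Possibly (c : Modality) {K : Type u} (M : KripkeModel.{u, v} K)
    (X : M.World → Prop) (w : M.World) : Prop :=
  (c.IsRestoration → ¬ X w) ∧ ∃ s, M.R w s ∧ X s

/-- The formula expressing `Modality.Possibly`. -/
def ModalFormula.possibly {K : Type u} {Λ : Set Modality} (φ : ModalFormula K Λ) :
    (c : Modality) → c ∈ Λ → ModalFormula K Λ
  | .diaNeg, hc => .modal .diaNeg hc (.neg φ)
  | .boxNeg, hc => .neg (.modal .boxNeg hc φ)
  | .cons, hc => .neg (.modal .cons hc (.neg φ))
  | .det, hc => .neg (.modal .det hc φ)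
  | .incons, hc => .modal .incons hc (.neg φ)
  | .undet, hc => .modal .undet hc φ

section Simulation

variable {K : Type u} {Λ : Set Modality} {M : KripkeModel.{u, v} K}
  {S : M.World → M.World → Prop} {c : Modality}

theorem sat_possibly (hc : c ∈ Λ) (φ : ModalFormula K Λ) (w : M.World) :
    Sat M (φ.possibly c hc) w ↔ c.Possibly M (Sat M φ) w := by
  cases c <;> simp [ModalFormula.possibly, Modality.Possibly, Modality.IsRestoration, Sat]

theorem simCondition_iff (hS : ∀ w v, S w v → S v w) :
    SimCondition M S c ↔ ∀ w v s, S w v → M.R w s →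
      c.IsRestoration ∧ S w s ∨ ∃ t, M.R v t ∧ S t s := by
  cases c <;> simp only [SimCondition, Modality.IsRestoration] <;> grind

theorem SimCondition.possibly (hc : SimCondition M S c) (hS : ∀ w v, S w v → S v w)
    {X : M.World → Prop} (hX : ∀ w v, S w v → (X w ↔ X v)) {w v : M.World} (hwv : S w v) :
    c.Possibly M X w → c.Possibly M X v := by
  rintro ⟨hw, s, hws, hs⟩
  refine ⟨fun hr => (hX w v hwv).not.1 (hw hr), ?_⟩
  obtain ⟨hr, hws'⟩ | ⟨t, hvt, hts⟩ := (simCondition_iff hS).1 hc w v s hwv hws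
  · exact absurd ((hX w s hws').2 hs) (hw hr)
  · exact ⟨t, hvt, (hX t s hts).2 hs⟩

theorem SimCondition.sat_modal_iff (hcond : SimCondition M S c) (hS : ∀ w v, S w v → S v w)
    {φ : ModalFormula K Λ} (hφ : ∀ w v, S w v → (Sat M φ w ↔ Sat M φ v)) (hc : c ∈ Λ)
    {w v : M.World} (hwv : S w v) :
    Sat M (.modal c hc φ) w ↔ Sat M (.modal c hc φ) v := by
  have invariant {X : M.World → Prop} (hX : ∀ w v, S w v → (X w ↔ X v)) :
      c.Possibly M X w ↔ c.Possibly M X v :=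
    ⟨hcond.possibly hS hX hwv, hcond.possibly hS hX (hS w v hwv)⟩
  have pos := invariant hφ
  have neg := invariant fun w v h => (hφ w v h).not
  cases c <;> simp only [Modality.Possibly, Modality.IsRestoration, Sat] at pos neg ⊢ <;> grind

theorem IsSymmetricalSimulation.sat_iff (hS : IsSymmetricalSimulation Λ M S)
    (φ : ModalFormula K Λ) {w v : M.World} (hwv : S w v) : Sat M φ w ↔ Sat M φ v := by
  induction φ generalizing w v with
  | letter k => exact ⟨hS.letter k w v hwv, hS.letter k v w (hS.symm w v hwv)⟩
  | top | bot => exact Iff.rfl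
  | and φ ψ ihφ ihψ | or φ ψ ihφ ihψ => simp only [Sat, ihφ hwv, ihψ hwv]
  | neg φ ih => simp only [Sat, ih hwv]
  | modal c hc φ ih => exact (hS.modal c hc).sat_modal_iff hS.symm (fun _ _ => ih) hc hwv

end Simulation

theorem isInvariant_standardTranslation {K : Type u} {Λ : Set Modality} (φ : ModalFormula K Λ) :
    IsInvariant.{u, v} Λ (standardTranslation φ) := by
  intro M N S hS w w' hww'
  simp only [holds_standardTranslation]
  rw [← isBoundedMorphism_inl.sat_iff (N := M.disjointUnion N), hS.sat_iff φ hww',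
    isBoundedMorphism_inr.sat_iff]

theorem isInvariant_congr {K : Type u} {Λ : Set Modality} {α β : FOFormula K}
    (h : Equivalent.{u, v} α β) : IsInvariant.{u, v} Λ α ↔ IsInvariant.{u, v} Λ β := by
  simp only [IsInvariant, h _ _]

/-! ### Saturated models -/

/-- Modal equivalence of pointed models: the same formulas over `Λ` are true at `w` and `v`. -/
def ModallyEquivalent {K : Type u} (Λ : Set Modality) (M : KripkeModel.{u, v} K) (w : M.World)
    (N : KripkeModel.{u, v} K) (v : N.World) : Prop :=
  ∀ φ : ModalFormula K Λ, Sat M φ w ↔ Sat N φ v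

/-- Modal saturation at a world: a set of formulas is satisfiable among the successors of `w` as
soon as each of its finite subsets is. -/
def IsSaturatedAt {K : Type u} (Λ : Set Modality) (M : KripkeModel.{u, v} K) (w : M.World) :
    Prop :=
  ∀ Γ : Set (ModalFormula K Λ),
    (∀ Δ ⊆ Γ, Δ.Finite → ∃ s, M.R w s ∧ ∀ φ ∈ Δ, Sat M φ s) → ∃ s, M.R w s ∧ ∀ φ ∈ Γ, Sat M φ s

section Saturation

variable {K : Type u} {Λ : Set Modality} {M N : KripkeModel.{u, v} K}

theorem ModallyEquivalent.symm {w : M.World} {v : N.World} (h : ModallyEquivalent Λ M w N v) :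
    ModallyEquivalent Λ N v M w :=
  fun φ => (h φ).symm

theorem modallyEquivalent_of_forall_imp {w : M.World} {v : N.World}
    (h : ∀ φ : ModalFormula K Λ, Sat M φ w → Sat N φ v) : ModallyEquivalent Λ M w N v :=
  fun φ => ⟨h φ, not_imp_not.1 (h (.neg φ))⟩

theorem exists_sat_iff_forall_mem {Δ : Set (ModalFormula K Λ)} (hΔ : Δ.Finite) :
    ∃ ψ : ModalFormula K Λ, ∀ (M : KripkeModel.{u, v} K) (w : M.World),
      Sat M ψ w ↔ ∀ φ ∈ Δ, Sat M φ w := by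
  induction Δ, hΔ using Set.Finite.induction_on with
  | empty => exact ⟨.top, by simp [Sat]⟩
  | @insert φ Δ _ _ ih =>
    obtain ⟨ψ, hψ⟩ := ih
    exact ⟨.and φ ψ, by simp [Sat, hψ]⟩

theorem IsBoundedMorphism.isSaturatedAt {f : M.World → N.World} (hf : IsBoundedMorphism f)
    {w : M.World} (hw : IsSaturatedAt Λ M w) : IsSaturatedAt Λ N (f w) := by
  intro Γ hΓ
  simp only [hf.succ, ↓existsAndEq, and_true, hf.sat_iff] at hΓ ⊢
  exact hw Γ hΓ

theorem IsSaturatedAt.exists_succ_modallyEquivalent {v : M.World} (hv : IsSaturatedAt Λ M v)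
    {s : N.World} (h : ∀ φ : ModalFormula K Λ, Sat N φ s → ∃ t, M.R v t ∧ Sat M φ t) :
    ∃ t, M.R v t ∧ ModallyEquivalent Λ N s M t := by
  obtain ⟨t, hvt, ht⟩ := hv {φ | Sat N φ s} fun Δ hΔ hfin => by
    obtain ⟨ψ, hψ⟩ := exists_sat_iff_forall_mem.{u, v} hfin
    obtain ⟨t, hvt, ht⟩ := h ψ ((hψ N s).2 hΔ)
    exact ⟨t, hvt, (hψ M t).1 ht⟩
  exact ⟨t, hvt, modallyEquivalent_of_forall_imp ht⟩

theorem simCondition_modallyEquivalent (hM : ∀ w, IsSaturatedAt Λ M w) {c : Modality}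
    (hc : c ∈ Λ) : SimCondition M (ModallyEquivalent Λ M · M ·) c := by
  refine (simCondition_iff fun _ _ => ModallyEquivalent.symm).2 fun w v s hwv hws => ?_
  refine or_iff_not_imp_left.2 fun hs => ?_
  obtain ⟨χ, hχs, hχw⟩ : ∃ χ : ModalFormula K Λ, Sat M χ s ∧ (c.IsRestoration → ¬ Sat M χ w) := by
    by_contra! hcon
    have hr := (hcon .top trivial).1
    exact hs ⟨hr, (modallyEquivalent_of_forall_imp fun φ hφ => (hcon φ hφ).2).symm⟩
  obtain ⟨t, hvt, hst⟩ := (hM v).exists_succ_modallyEquivalent (s := s) fun φ hφ => by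
    have hw : c.Possibly M (Sat M (.and χ φ)) w := ⟨fun hr h => hχw hr h.1, s, hws, hχs, hφ⟩
    obtain ⟨-, t, hvt, -, ht⟩ : c.Possibly M (Sat M (.and χ φ)) v := by
      simpa only [sat_possibly] using (hwv (.possibly (.and χ φ) c hc)).1
        ((sat_possibly hc _ w).2 hw)
    exact ⟨t, hvt, ht⟩
  exact ⟨t, hvt, hst.symm⟩

theorem isSymmetricalSimulation_modallyEquivalent (hM : ∀ w, IsSaturatedAt Λ M w) :
    IsSymmetricalSimulation Λ M (ModallyEquivalent Λ M · M ·) where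
  letter k _ _ hwv := (hwv (.letter k)).1
  modal _ hc := simCondition_modallyEquivalent hM hc
  symm _ _ := ModallyEquivalent.symm

theorem IsInvariant.holds_iff_of_isSaturatedAt {α : FOFormula K} (hα : IsInvariant.{u, v} Λ α)
    (hM : ∀ w, IsSaturatedAt Λ M w) (hN : ∀ v, IsSaturatedAt Λ N v) {w : M.World} {v : N.World}
    (hwv : ModallyEquivalent Λ M w N v) : Holds M α w ↔ Holds N α v := by
  refine hα M N _ (isSymmetricalSimulation_modallyEquivalent ?_) w v fun φ => ?_
  · rintro (w | v)
    exacts [isBoundedMorphism_inl.isSaturatedAt (hM w), isBoundedMorphism_inr.isSaturatedAt (hN v)]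
  · rw [isBoundedMorphism_inl.sat_iff, isBoundedMorphism_inr.sat_iff, hwv φ]

end Saturation

/-! ### Countable saturation of ultraproducts -/

section Countability

variable {K : Type u} {Λ : Set Modality}

/-- Prefix (Polish) notation, which shows that there are only countably many formulas over
countably many letters. The five connectives other than the modalities are numbered. -/
def ModalFormula.polish : ModalFormula K Λ → List (K ⊕ Fin 5 ⊕ Modality)
  | .letter k => [.inl k]
  | .top => [.inr (.inl 0)]
  | .bot => [.inr (.inl 1)]
  | .and φ ψ => .inr (.inl 2) :: (φ.polish ++ ψ.polish)
  | .or φ ψ => .inr (.inl 3) :: (φ.polish ++ ψ.polish)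
  | .neg φ => .inr (.inl 4) :: φ.polish
  | .modal c _ φ => .inr (.inr c) :: φ.polish

theorem ModalFormula.polish_append_inj (φ ψ : ModalFormula K Λ)
    {l l' : List (K ⊕ Fin 5 ⊕ Modality)} (h : φ.polish ++ l = ψ.polish ++ l') :
    φ = ψ ∧ l = l' := by
  induction φ generalizing ψ l l' <;> cases ψ <;> grind [polish]

theorem ModalFormula.polish_injective : Function.Injective (polish (K := K) (Λ := Λ)) :=
  fun φ ψ h => (polish_append_inj φ ψ (congrArg (· ++ []) h)).1

instance : Countable Modality :=
  Function.Injective.countable (f := Modality.ctorIdx) (by rintro ⟨⟩ ⟨⟩ h <;> first | rfl | cases h)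

instance [Countable K] : Countable (ModalFormula K Λ) :=
  ModalFormula.polish_injective.countable

end Countability

theorem exists_tendsto_atTop_and_eventually {ι : Type*} {l : Filter ι} {r : ι → ℕ}
    (hr : Tendsto r l atTop) {Q : ι → ℕ → Prop} (hQ : ∀ m, ∀ᶠ i in l, Q i m) :
    ∃ k : ι → ℕ, Tendsto k l atTop ∧ ∀ᶠ i in l, Q i (k i) := by
  classical
  refine ⟨fun i => Nat.findGreatest (Q i) (r i), tendsto_atTop.2 fun m => ?_, ?_⟩
  · filter_upwards [hQ m, hr.eventually_ge_atTop m] with i hQm hm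
    exact Nat.le_findGreatest hm hQm
  · filter_upwards [hQ 0] with i hQ0
    exact Nat.findGreatest_spec (Nat.zero_le _) hQ0

/-- A nonempty first-order structure regarded as a Kripke model. -/
def KripkeModel.ofStructure {K : Type u} (W : Type v) [Nonempty W]
    [(kripkeLanguage K).Structure W] : KripkeModel.{u, v} K where
  World := W
  nonempty := ‹_›
  R x y := Structure.RelMap (symR K) ![x, y]
  P k x := Structure.RelMap (symP k) ![x]

theorem toStructure_ofStructure {K : Type u} (W : Type v) [Nonempty W]
    [h : (kripkeLanguage K).Structure W] :
    (KripkeModel.ofStructure (K := K) W).toStructure = h := by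
  ext n r xs
  · exact nomatch r
  · cases r with
    | acc => exact iff_of_eq (congrArg (h.RelMap (symR K)) (List.ofFn_inj.1 rfl))
    | pred k => exact iff_of_eq (congrArg (h.RelMap (symP k)) (List.ofFn_inj.1 rfl))

instance {K : Type u} (M : KripkeModel.{u, v} K) : Nonempty M.World := M.nonempty

section Ultraproduct

variable {K : Type u} {Λ : Set Modality} {ι : Type w} (U : Ultrafilter ι)
  (M : ι → KripkeModel.{u, max v w} K)

/-- The ultraproduct of a family of Kripke models. -/
def ultraproduct : KripkeModel.{u, max v w} K :=
  .ofStructure ((U : Filter ι).Product fun i => (M i).World)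

variable {U M}

/-- The world of an ultraproduct represented by a family of worlds. -/
def ultraWorld (f : ∀ i, (M i).World) : (ultraproduct U M).World :=
  Quotient.mk'' f

theorem ultraWorld_surjective :
    Function.Surjective (ultraWorld : (∀ i, (M i).World) → (ultraproduct U M).World) :=
  Quotient.mk''_surjective

theorem realize_ultraproduct {γ : Type*} {n : ℕ} (β : (kripkeLanguage K).BoundedFormula γ n)
    (e : γ → ∀ i, (M i).World) (xs : Fin n → ∀ i, (M i).World) :
    β.Realize (M := (ultraproduct U M).World) (fun x => ultraWorld (e x))
        (fun j => ultraWorld (xs j)) ↔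
      ∀ᶠ i in U, β.Realize (fun x => e x i) (fun j => xs j i) := by
  unfold ultraproduct
  rw [toStructure_ofStructure]
  exact Ultraproduct.boundedFormula_realize_cast β e xs

theorem holds_ultraproduct (α : FOFormula K) (f : ∀ i, (M i).World) :
    Holds (ultraproduct U M) α (ultraWorld f) ↔ ∀ᶠ i in U, Holds (M i) α (f i) := by
  have h := realize_ultraproduct (U := U) α (fun _ => f) Fin.elim0
  simpa only [Holds, Formula.Realize, Unique.eq_default] using h

theorem sat_ultraproduct (φ : ModalFormula K Λ) (f : ∀ i, (M i).World) :
    Sat (ultraproduct U M) φ (ultraWorld f) ↔ ∀ᶠ i in U, Sat (M i) φ (f i) := by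
  simp only [← holds_standardTranslation, holds_ultraproduct]

theorem ultraproduct_R (f g : ∀ i, (M i).World) :
    (ultraproduct U M).R (ultraWorld f) (ultraWorld g) ↔ ∀ᶠ i in U, (M i).R (f i) (g i) := by
  have h := realize_ultraproduct (U := U) (atomR (.inl ()) (.inr 0)) (fun _ => f) fun _ : Fin 1 => g
  simp only [realize_atomR, Sum.elim_inl, Sum.elim_inr] at h
  exact h

theorem isSaturatedAt_ultraproduct [Countable K] {r : ι → ℕ} (hr : Tendsto r U atTop)
    (w : (ultraproduct U M).World) : IsSaturatedAt Λ (ultraproduct U M) w := by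
  intro Γ hΓ
  obtain ⟨f, rfl⟩ := ultraWorld_surjective w
  obtain ⟨e, he⟩ := exists_injective_nat (ModalFormula K Λ)
  have hfin (m : ℕ) : {φ ∈ Γ | e φ < m}.Finite :=
    ((Set.finite_Iio m).preimage he.injOn).subset fun _ hφ => hφ.2
  have hQ (m : ℕ) : ∀ᶠ i in U, ∃ s, (M i).R (f i) s ∧ ∀ φ ∈ {φ ∈ Γ | e φ < m}, Sat (M i) φ s := by
    obtain ⟨s, hws, hs⟩ := hΓ {φ ∈ Γ | e φ < m} (Set.sep_subset _ _) (hfin m)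
    obtain ⟨g, rfl⟩ := ultraWorld_surjective s
    have hg := (eventually_all_finite (hfin m)).2 fun φ hφ => (sat_ultraproduct φ g).1 (hs φ hφ)
    filter_upwards [(ultraproduct_R f g).1 hws, hg] with i hR hsat
    exact ⟨g i, hR, hsat⟩
  obtain ⟨k, hk, hkQ⟩ := exists_tendsto_atTop_and_eventually hr hQ
  obtain ⟨g, hg⟩ := skolem.1 hkQ
  refine ⟨ultraWorld g, (ultraproduct_R f g).2 (hg.mono fun _ h => h.1), fun φ hφ => ?_⟩
  refine (sat_ultraproduct φ g).2 ?_
  filter_upwards [hg, hk.eventually_gt_atTop (e φ)] with i hi hei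
  exact hi.2 φ ⟨hφ, hei⟩

end Ultraproduct

/-! ### Characterization over countably many letters -/

section Countable

variable {K : Type u} {Λ : Set Modality}

theorem exists_sat_iff_of_agree {Δ : Set (ModalFormula K Λ)} (hΔ : Δ.Finite)
    {Q : ∀ M : KripkeModel.{u, v} K, M.World → Prop}
    (hQ : ∀ M w N v, (∀ φ ∈ Δ, Sat M φ w ↔ Sat N φ v) → Q M w → Q N v) :
    ∃ ψ : ModalFormula K Λ, ∀ M w, Q M w ↔ Sat M ψ w := by
  induction Δ, hΔ using Set.Finite.induction_on generalizing Q with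
  | empty =>
    by_cases h : ∃ M w, Q M w
    · obtain ⟨M, w, hw⟩ := h
      exact ⟨.top, fun N v => iff_of_true (hQ M w N v (by simp) hw) trivial⟩
    · exact ⟨.bot, fun M w => iff_of_false (fun hw => h ⟨M, w, hw⟩) id⟩
  | @insert χ Δ _ _ ih =>
    have hsplit (b : Prop) : ∃ ψ : ModalFormula K Λ, ∀ (M : KripkeModel.{u, v} K) (w : M.World),
        (∃ (N : KripkeModel.{u, v} K) (v : N.World),
          (∀ φ ∈ Δ, Sat N φ v ↔ Sat M φ w) ∧ (Sat N χ v ↔ b) ∧ Q N v) ↔ Sat M ψ w := by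
      refine ih ?_
      rintro M w M' w' hww' ⟨N, v, hvw, hb, hv⟩
      exact ⟨N, v, fun φ hφ => (hvw φ hφ).trans (hww' φ hφ), hb, hv⟩
    obtain ⟨ψ, hψ⟩ := hsplit True
    obtain ⟨θ, hθ⟩ := hsplit False
    refine ⟨.or (.and χ ψ) (.and (.neg χ) θ), fun M w => ?_⟩
    simp only [Sat, ← hψ, ← hθ]
    constructor
    · intro hw
      by_cases h : Sat M χ w
      · exact .inl ⟨h, M, w, by simp [h, hw]⟩
      · exact .inr ⟨h, M, w, by simp [h, hw]⟩
    · rintro (⟨h, N, v, hvw, hb, hv⟩ | ⟨h, N, v, hvw, hb, hv⟩) <;>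
        exact hQ N v M w (by simpa [h, hb] using hvw) hv

theorem IsInvariant.exists_finite_agree [Countable K] {α : FOFormula K}
    (hα : IsInvariant.{u, v} Λ α) :
    ∃ Δ : Set (ModalFormula K Λ), Δ.Finite ∧ ∀ (M : KripkeModel.{u, v} K) (w : M.World)
      (N : KripkeModel.{u, v} K) (v : N.World),
      (∀ φ ∈ Δ, Sat M φ w ↔ Sat N φ v) → Holds M α w → Holds N α v := by
  obtain ⟨e, he⟩ := exists_injective_nat (ModalFormula K Λ)
  have hfin (n : ℕ) : {φ | e φ < n}.Finite := (Set.finite_Iio n).preimage he.injOn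
  by_contra! hcon
  choose M w N v hagree hM hN using fun n => hcon _ (hfin n)
  have hequiv : ModallyEquivalent Λ (ultraproduct (hyperfilter ℕ) M) (ultraWorld w)
      (ultraproduct (hyperfilter ℕ) N) (ultraWorld v) := fun φ => by
    rw [sat_ultraproduct, sat_ultraproduct]
    refine eventually_congr (Nat.hyperfilter_le_atTop ?_)
    filter_upwards [eventually_gt_atTop (e φ)] with n hn
    exact hagree n φ hn
  have hsat (M : ℕ → KripkeModel.{u, v} K) :=
    isSaturatedAt_ultraproduct (Λ := Λ) (M := M) (r := id) Nat.hyperfilter_le_atTop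
  have hiff := hα.holds_iff_of_isSaturatedAt (hsat M) (hsat N) hequiv
  rw [holds_ultraproduct, holds_ultraproduct] at hiff
  obtain ⟨n, hn⟩ := (hiff.1 (.of_forall hM)).exists
  exact hN n hn

theorem IsInvariant.exists_equivalent_of_countable [Countable K] {α : FOFormula K}
    (hα : IsInvariant.{u, v} Λ α) :
    ∃ φ : ModalFormula K Λ, Equivalent.{u, v} α (standardTranslation φ) := by
  obtain ⟨Δ, hΔ, hαΔ⟩ := hα.exists_finite_agree
  obtain ⟨φ, hφ⟩ := exists_sat_iff_of_agree hΔ hαΔ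
  exact ⟨φ, fun M w => (hφ M w).trans (holds_standardTranslation φ w).symm⟩

end Countable

/-! ### Renaming letters -/

section Renaming

variable {K : Type u} {J : Type w} {Λ : Set Modality}

/-- The model over `K` in which `k` is interpreted as `f k` was. -/
def KripkeModel.comap (f : K → J) (M : KripkeModel.{w, v} J) : KripkeModel.{u, v} K where
  World := M.World
  nonempty := M.nonempty
  R := M.R
  P k := M.P (f k)

/-- The translation of first-order languages that renames the letter `k` to `f k`. -/
def renameHom (f : K → J) : kripkeLanguage K →ᴸ kripkeLanguage J where
  onFunction := nofun
  onRelation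
    | _, .acc => .acc
    | _, .pred k => .pred (f k)

/-- Renaming of letters in a modal formula. -/
def ModalFormula.map (f : K → J) : ModalFormula K Λ → ModalFormula J Λ
  | .letter k => .letter (f k)
  | .top => .top
  | .bot => .bot
  | .and φ ψ => .and (φ.map f) (ψ.map f)
  | .or φ ψ => .or (φ.map f) (ψ.map f)
  | .neg φ => .neg (φ.map f)
  | .modal c hc φ => .modal c hc (φ.map f)

theorem sat_map (f : K → J) (M : KripkeModel.{w, v} J) (φ : ModalFormula K Λ) (w : M.World) :
    Sat M (φ.map f) w ↔ Sat (M.comap f) φ w := by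
  induction φ generalizing w with
  | letter | top | bot => exact Iff.rfl
  | and φ ψ ihφ ihψ | or φ ψ ihφ ihψ => simp only [ModalFormula.map, Sat, ihφ, ihψ]
  | neg φ ih => simp only [ModalFormula.map, Sat, ih]
  | modal c hc φ ih => cases c <;> simp only [ModalFormula.map, Sat, ih] <;> rfl

theorem holds_onFormula (f : K → J) (M : KripkeModel.{w, v} J) (α : FOFormula K) (w : M.World) :
    Holds M ((renameHom f).onFormula α) w ↔ Holds (M.comap f) α w := by
  let _ : (kripkeLanguage K).Structure M.World := (M.comap f).toStructure
  have : (renameHom f).IsExpansionOn M.World :=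
    { map_onFunction := nofun
      map_onRelation := fun r _ => by cases r <;> rfl }
  exact LHom.realize_onFormula _ α

theorem IsInvariant.onFormula (f : K → J) {α : FOFormula K} (hα : IsInvariant.{u, v} Λ α) :
    IsInvariant.{w, v} Λ ((renameHom f).onFormula α) := by
  intro M N S hS w w' hww'
  rw [holds_onFormula, holds_onFormula]
  have letter k (x : ((M.comap f).disjointUnion (N.comap f)).World) :
      ((M.comap f).disjointUnion (N.comap f)).P k x ↔ (M.disjointUnion N).P (f k) x := by
    cases x <;> rfl
  refine hα (M.comap f) (N.comap f) S ⟨⟨fun k x y hxy => ?_, fun c hc => ?_⟩, hS.symm⟩ w w' hww'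
  · simpa only [letter] using hS.letter (f k) x y hxy
  · have := hS.modal c hc
    cases c <;> exact this

theorem renameHom_comp {I : Type*} (g : J → I) (f : K → J) :
    (renameHom g).comp (renameHom f) = renameHom (g ∘ f) := by
  ext n x
  · exact nomatch x
  · cases x <;> rfl

theorem exists_finite_onBoundedFormula_eq {γ : Type*} {n : ℕ}
    (β : (kripkeLanguage K).BoundedFormula γ n) :
    ∃ A : Set K, A.Finite ∧ ∀ f : K → K, (∀ k ∈ A, f k = k) →
      (renameHom f).onBoundedFormula β = β := by
  have onTerm_eq {n} (f : K → K) (t : (kripkeLanguage K).Term (γ ⊕ Fin n)) :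
      (renameHom f).onTerm t = t := by
    cases t with
    | var => rfl
    | func g => exact nomatch g
  induction β with
  | falsum => exact ⟨∅, Set.finite_empty, fun _ _ => rfl⟩
  | equal t₁ t₂ =>
    exact ⟨∅, Set.finite_empty, fun f _ => congrArg₂ _ (onTerm_eq f t₁) (onTerm_eq f t₂)⟩
  | rel r ts =>
    have hts f : (renameHom f).onTerm ∘ ts = ts := funext fun i => onTerm_eq f (ts i)
    cases r with
    | acc => exact ⟨∅, Set.finite_empty, fun f _ => congrArg _ (hts f)⟩
    | pred k =>
      exact ⟨{k}, Set.finite_singleton k, fun f hf =>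
        congrArg₂ (fun k => BoundedFormula.rel (symP k)) (hf k rfl) (hts f)⟩
  | imp β₁ β₂ ih₁ ih₂ =>
    obtain ⟨A₁, hA₁, h₁⟩ := ih₁
    obtain ⟨A₂, hA₂, h₂⟩ := ih₂
    exact ⟨A₁ ∪ A₂, hA₁.union hA₂, fun f hf => congrArg₂ _
      (h₁ f fun k hk => hf k (.inl hk)) (h₂ f fun k hk => hf k (.inr hk))⟩
  | all β ih =>
    obtain ⟨A, hA, h⟩ := ih
    exact ⟨A, hA, fun f hf => congrArg _ (h f hf)⟩

end Renaming

theorem exists_onFormula_onFormula_eq {K : Type u} [Nonempty K] (α : FOFormula K) :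
    ∃ (f : K → ℕ) (g : ℕ → K), (renameHom g).onFormula ((renameHom f).onFormula α) = α := by
  obtain ⟨A, hA, hαA⟩ := exists_finite_onBoundedFormula_eq α
  obtain ⟨g, hg⟩ := Set.countable_iff_exists_subset_range.1 hA.countable
  refine ⟨Function.invFun g, g, ?_⟩
  calc (renameHom g).onFormula ((renameHom (Function.invFun g)).onFormula α)
      = (renameHom (g ∘ Function.invFun g)).onFormula α := by
        rw [← renameHom_comp]
        exact (congrFun (LHom.comp_onBoundedFormula _ _) α).symm
    _ = α := hαA _ fun k hk => Function.invFun_eq (hg hk)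

theorem IsInvariant.exists_equivalent {K : Type u} {Λ : Set Modality} {α : FOFormula K}
    (hα : IsInvariant.{u, v} Λ α) :
    ∃ φ : ModalFormula K Λ, Equivalent.{u, v} α (standardTranslation φ) := by
  cases isEmpty_or_nonempty K with
  | inl _ => exact hα.exists_equivalent_of_countable
  | inr _ =>
    obtain ⟨f, g, hfg⟩ := exists_onFormula_onFormula_eq α
    obtain ⟨φ, hφ⟩ := (hα.onFormula f).exists_equivalent_of_countable
    refine ⟨φ.map g, fun M w => ?_⟩
    calc Holds M α w
        ↔ Holds M ((renameHom g).onFormula ((renameHom f).onFormula α)) w := by rw [hfg]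
      _ ↔ Holds (M.comap g) ((renameHom f).onFormula α) w := holds_onFormula g M _ w
      _ ↔ Holds (M.comap g) (standardTranslation φ) w := hφ (M.comap g) w
      _ ↔ Sat (M.comap g) φ w := holds_standardTranslation φ _
      _ ↔ Sat M (φ.map g) w := (sat_map g M φ w).symm
      _ ↔ Holds M (standardTranslation (φ.map g)) w := (holds_standardTranslation _ w).symm

end Restorative


theorem theorem7p4_general {K : Type u} (Λ : Set Restorative.Modality)
    (α : Restorative.FOFormula K) :
    (∃ φ : Restorative.ModalFormula K Λ,
        Restorative.Equivalent.{u, v} α (Restorative.standardTranslation φ)) ↔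
      Restorative.IsInvariant.{u, v} Λ α :=
  ⟨fun ⟨φ, h⟩ => (Restorative.isInvariant_congr h).2
      (Restorative.isInvariant_standardTranslation φ),
    Restorative.IsInvariant.exists_equivalent⟩

theorem theorem7p4 {K : Type u} (Λ : Set Restorative.Modality) (α : Restorative.FOFormula K) :
    (∃ φ : Restorative.ModalFormula K Λ,
        Restorative.Equivalent.{u, max u v} α (Restorative.standardTranslation φ)) ↔
      Restorative.IsInvariant.{u, max u v} Λ α :=
  theorem7p4_general.{u, max u v} Λ α
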